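/- For an elliptic curve $E/\mathbb{Q}$, a subfield $F\subseteq\overline{\mathbb{Q}}$ and an integer $n\ge 1$, let $F(E[n])$ be the field generated over $F$ by the affine coordinates of the nonzero points of $E(\overline{\mathbb{Q}})$ killed by $n$. There are infinitely many $\mathbb{Q}$-isomorphism classes of elliptic curves $E/\mathbb{Q}$ such that: (i) $\mathbb{Q}(E[8])/\mathbb{Q}$ is a finite Galois extension with $\mathrm{Gal}(\mathbb{Q}(E[8])/\mathbb{Q})\cong(\mathbb{Z}/2\mathbb{Z})^t$ for some $t\ge 0$; (ii) the exact sequence given by restriction $$1\to\mathrm{Gal}(\mathbb{Q}(E[8])/\mathbb{Q}(E[4]))\to\mathrm{Gal}(\mathbb{Q}(E[8])/\mathbb{Q})\to\mathrm{Gal}(\mathbb{Q}(E[4])/\mathbb{Q})\to 1$$ is split, that is, the restriction map has a section which is a group homomorphism; (iii) there are an integer $r$ with $1\le r\le 4$ and a number field $L\subseteq\overline{\mathbb{Q}}$, Galois over $\mathbb{Q}$ with $\mathrm{Gal}(L/\mathbb{Q})\cong(\mathbb{Z}/2\mathbb{Z})^r$, such that $$L(E[4])=L(E[8])\neq L,$$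 and such that the base change from $\mathbb{Q}$ to $L$ is minimal for this coincidence: $L(E[4])=\mathbb{Q}(E[8])$ and $\mathbb{Q}(E[4])\cap L=\mathbb{Q}$. -/

import Mathlib

open scoped Classical in
/-- The set of affine coordinates, in the fixed algebraic closure of `ℚ`, of the nonzero geometric
points of `E` that are killed by `n`. -/
def torsionCoordinates (E : WeierstrassCurve ℚ) (n : ℕ) : Set (AlgebraicClosure ℚ) :=
  {z | ∃ (x y : AlgebraicClosure ℚ)
    (h : (E.baseChange (AlgebraicClosure ℚ)).toAffine.Nonsingular x y),
    n • (WeierstrassCurve.Affine.Point.some x y h) = 0 ∧ (z = x ∨ z = y)}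

/-- The `n`-division field `F(E[n])`, for a field `F` inside the fixed algebraic closure of `ℚ`
(used for `F = ℚ` and for number fields `F = L`). -/
noncomputable def divisionField (F : Type) [Field F] [Algebra F (AlgebraicClosure ℚ)]
    (E : WeierstrassCurve ℚ) (n : ℕ) : IntermediateField F (AlgebraicClosure ℚ) :=
  IntermediateField.adjoin F (torsionCoordinates E n)

/-- `K` is a number field, Galois over `ℚ` with Galois group isomorphic to `(ℤ/2ℤ)^r`. -/
def IsElementaryTwoExtension (K : Type) [Field K] [Algebra ℚ K] (r : ℕ) : Prop :=
  NumberField K ∧ IsGalois ℚ K ∧ Nonempty ((K ≃ₐ[ℚ] K) ≃* Multiplicative (Fin r → ZMod 2))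

/-- `K ⊆ M`, and the restriction map `Gal(M/ℚ) → Gal(K/ℚ)` has a section `s` that is a group
homomorphism: the restriction of `s σ` to `K` is `σ`. For `M` and `K` Galois over `ℚ` this says
that `1 → Gal(M/K) → Gal(M/ℚ) → Gal(K/ℚ) → 1` is split. -/
def RestrictionSplits (K M : IntermediateField ℚ (AlgebraicClosure ℚ)) : Prop :=
  ∃ (h : K ≤ M) (s : (K ≃ₐ[ℚ] K) →* (M ≃ₐ[ℚ] M)),
    ∀ (σ : K ≃ₐ[ℚ] K) (x : K),
      s σ (IntermediateField.inclusion h x) = IntermediateField.inclusion h (σ x)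

/-- The base change from `ℚ` to `L` is minimal for an `(m, n)`-coincidence (where `m ∣ n`):
`L(E[m]) = ℚ(E[n])` and `ℚ(E[m]) ∩ L = ℚ`. -/
def IsMinimalBaseChange (E : WeierstrassCurve ℚ) (m n : ℕ)
    (L : IntermediateField ℚ (AlgebraicClosure ℚ)) : Prop :=
  (divisionField L E m).restrictScalars ℚ = divisionField ℚ E n ∧
    divisionField ℚ E m ⊓ L = ⊥

/-- Isomorphism classes over `ℚ` of Weierstrass curves over `ℚ`: orbits under admissible changes of
variables with rational coefficients. -/
abbrev CurveClass : Type :=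
  MulAction.orbitRel.Quotient (WeierstrassCurve.VariableChange ℚ) (WeierstrassCurve ℚ)

/-! The curves are the twists y² = x(x + 9d)(x + 25d) with d = p prime. The differences of the roots
are, up to sign, d times 9, 16 and 25, all squares, so halving 2-torsion needs only i and √d:
ℚ(E[4]) ⊆ ℚ(i, √d). The differences between the abscissa of a 4-torsion point and the roots are
squares in ℚ(i, √2, √3, √5, √d), so this field contains ℚ(E[8]). The explicit halving formulas
behind both bounds are `two_nsmul_eq` and `exists_two_nsmul_eq`.

In the other direction, i ∈ ℚ(E[4]) and √10 ∈ ℚ(E[8]), while √10 ∉ ℚ(i, √p); hence ℚ ≠ ℚ(E[4]) ≠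
ℚ(E[8]).

The Galois group is now a finite 𝔽₂-vector space, so the restriction sequence splits and ℚ(E[4]) has
a complement L in ℚ(E[8]) (`exists_compl_finrank_le`). Since ℚ(E[4]) ≠ ℚ, L is a proper subfield of
a field of degree at most 2⁵, whence r ≤ 4. Comparing c₄ and c₆ shows that distinct primes give
non-isomorphic curves. -/

/-! ### Groups of exponent two as vector spaces over 𝔽₂ -/

section ExponentTwo

variable {G H : Type*} [Group G] [Group H]

/-- A group in which every element squares to one is commutative. -/
abbrev commGroupOfMulSelf (hG : ∀ g : G, g * g = 1) : CommGroup G where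
  mul_comm a b := by
    have inv_eq : ∀ g : G, g⁻¹ = g := fun g => inv_eq_of_mul_eq_one_left (hG g)
    rw [← inv_eq (a * b), mul_inv_rev, inv_eq, inv_eq]

/-- A group in which every element squares to one is a vector space over `ZMod 2`. -/
abbrev zmodTwoModuleOfMulSelf {G : Type*} [CommGroup G] (hG : ∀ g : G, g * g = 1) :
    Module (ZMod 2) (Additive G) :=
  AddCommGroup.zmodModule fun x => by
    rw [two_nsmul]
    exact congrArg Additive.ofMul (hG x.toMul)

theorem exists_mulEquiv_zmodTwo_of_mul_self [Finite G] (hG : ∀ g : G, g * g = 1) :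
    ∃ r : ℕ, Nonempty (G ≃* Multiplicative (Fin r → ZMod 2)) := by
  let := commGroupOfMulSelf hG
  let := zmodTwoModuleOfMulSelf hG
  exact ⟨_, ⟨AddEquiv.toMultiplicativeRight
    (Module.finBasis (ZMod 2) (Additive G)).equivFun.toAddEquiv⟩⟩

/-- Both groups are 𝔽₂-vector spaces and f is linear, so a linear section exists. -/
theorem MonoidHom.exists_rightInverse_of_mul_self (hG : ∀ g : G, g * g = 1) (f : G →* H)
    (hf : Function.Surjective f) : ∃ s : H →* G, ∀ h, f (s h) = h := by
  have hH : ∀ h : H, h * h = 1 := fun h => by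
    obtain ⟨g, rfl⟩ := hf h
    rw [← map_mul, hG, map_one]
  let := commGroupOfMulSelf hG
  let := commGroupOfMulSelf hH
  let := zmodTwoModuleOfMulSelf hG
  let := zmodTwoModuleOfMulSelf hH
  let F : Additive G →ₗ[ZMod 2] Additive H := (MonoidHom.toAdditive f).toZModLinearMap 2
  obtain ⟨s, hs⟩ := F.exists_rightInverse_of_surjective
    (LinearMap.range_eq_top.2 fun x => hf x.toMul)
  refine ⟨MonoidHom.toAdditive.symm s.toAddMonoidHom, fun h => ?_⟩
  exact congrArg Additive.toMul (LinearMap.congr_fun hs (Additive.ofMul h))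

theorem Subgroup.complementedLattice_of_mul_self (hG : ∀ g : G, g * g = 1) :
    ComplementedLattice (Subgroup G) := by
  let := commGroupOfMulSelf hG
  let := zmodTwoModuleOfMulSelf hG
  exact (Subgroup.toAddSubgroup.trans
    (AddSubgroup.toZModSubmodule 2)).symm.complementedLattice

end ExponentTwo

/-! ### Multiquadratic extensions -/

namespace IntermediateField

variable {F E : Type*} [Field F] [Field E] [Algebra F E]

theorem finrank_adjoin_simple_le_two {x : E} {q : F} (hx : x ^ 2 = algebraMap F E q) :
    FiniteDimensional F F⟮x⟯ ∧ Module.finrank F F⟮x⟯ ≤ 2 := by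
  have hint : IsIntegral F x := ⟨Polynomial.X ^ 2 - Polynomial.C q,
    Polynomial.monic_X_pow_sub_C q two_ne_zero, by simp [hx]⟩
  refine ⟨adjoin.finiteDimensional hint, ?_⟩
  rw [adjoin.finrank hint]
  exact (Polynomial.natDegree_le_of_dvd (minpoly.dvd F x (p := Polynomial.X ^ 2 - Polynomial.C q)
    (by simp [hx])) (Polynomial.X_pow_sub_C_ne_zero two_pos q)).trans
    (Polynomial.natDegree_X_pow_sub_C).le

theorem finrank_adjoin_sqrt_le [DecidableEq E] (S : Finset E)
    (hS : ∀ x ∈ S, ∃ q : F, x ^ 2 = algebraMap F E q) :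
    FiniteDimensional F (adjoin F (S : Set E)) ∧
      Module.finrank F (adjoin F (S : Set E)) ≤ 2 ^ S.card := by
  induction S using Finset.induction_on with
  | empty =>
    rw [Finset.coe_empty, adjoin_empty]
    exact ⟨inferInstance, by simp⟩
  | insert x S hx ih =>
    obtain ⟨hf, hr⟩ := ih fun y hy => hS y (Finset.mem_insert_of_mem hy)
    obtain ⟨q, hq⟩ := hS x (Finset.mem_insert_self x S)
    obtain ⟨hf', hr'⟩ := finrank_adjoin_simple_le_two hq
    rw [Finset.coe_insert, Set.insert_eq, adjoin_union, Finset.card_insert_of_notMem hx, pow_succ']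
    exact ⟨finiteDimensional_sup _ _, (finrank_sup_le _ _).trans (Nat.mul_le_mul hr' hr)⟩

/-- An automorphism sends each generating square root to plus or minus itself, so its square fixes
all generators. -/
theorem algEquiv_mul_self_eq_one_of_adjoin_sqrt {S : Set E}
    (hS : ∀ x ∈ S, ∃ q : F, x ^ 2 = algebraMap F E q)
    (σ : adjoin F S ≃ₐ[F] adjoin F S) : σ * σ = 1 := by
  have key : (σ * σ).toAlgHom = AlgHom.id F _ := by
    refine adjoin_algHom_ext F fun x hx => ?_
    obtain ⟨q, hq⟩ := hS x hx
    set z : adjoin F S := ⟨x, subset_adjoin F S hx⟩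
    have hz : z ^ 2 = algebraMap F _ q := Subtype.ext hq
    have h2 : σ z ^ 2 = z ^ 2 := by rw [← map_pow, hz, AlgEquiv.commutes]
    change σ (σ z) = z
    rcases sq_eq_sq_iff_eq_or_eq_neg.1 h2 with h | h <;> simp [h]
  exact AlgEquiv.ext fun x => DFunLike.congr_fun key x

theorem normal_adjoin_sqrt [Normal F E] {S : Set E}
    (hS : ∀ x ∈ S, ∃ q : F, x ^ 2 = algebraMap F E q) : Normal F (adjoin F S) := by
  refine normal_iff_forall_map_le.2 fun σ => ?_
  rw [adjoin_map, adjoin_le_iff]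
  rintro _ ⟨x, hx, rfl⟩
  obtain ⟨q, hq⟩ := hS x hx
  have h2 : σ x ^ 2 = x ^ 2 := by rw [← map_pow, hq, AlgHom.commutes]
  rcases sq_eq_sq_iff_eq_or_eq_neg.1 h2 with h | h
  · exact Set.mem_of_eq_of_mem h (subset_adjoin F S hx)
  · exact Set.mem_of_eq_of_mem h (neg_mem (subset_adjoin F S hx))

/-- In a finite Galois extension whose Galois group has exponent two, every intermediate field has
a complement. -/
theorem exists_isCompl_of_mul_self [FiniteDimensional F E] [IsGalois F E]
    (hE : ∀ σ : E ≃ₐ[F] E, σ * σ = 1) (K : IntermediateField F E) : ∃ L, IsCompl K L := by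
  have := Subgroup.complementedLattice_of_mul_self hE
  exact ((IsGalois.intermediateFieldEquivSubgroup (F := F) (E := E)).symm.complementedLattice
    ).exists_isCompl K

/-- `M` is a finite Galois extension whose Galois group has exponent two. -/
structure IsMultiquadratic (M : IntermediateField F E) : Prop where
  finiteDimensional : FiniteDimensional F M
  isGalois : IsGalois F M
  mul_self : ∀ σ : M ≃ₐ[F] M, σ * σ = 1

theorem isMultiquadratic_adjoin_sqrt [CharZero F] [Normal F E] (S : Finset E)
    (hS : ∀ x ∈ S, ∃ q : F, x ^ 2 = algebraMap F E q) :
    IsMultiquadratic (adjoin F (S : Set E)) := by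
  classical
  have := normal_adjoin_sqrt (S := (S : Set E)) hS
  exact ⟨(finrank_adjoin_sqrt_le S hS).1, ⟨⟩, algEquiv_mul_self_eq_one_of_adjoin_sqrt hS⟩

/-- Exponent two makes the Galois group abelian, so every subfield is normal and restriction to it
is defined. -/
theorem exists_restrict_of_le {K M : IntermediateField F E} (hM : IsMultiquadratic M)
    (h : K ≤ M) : IsGalois F K ∧ ∃ f : (M ≃ₐ[F] M) →* (K ≃ₐ[F] K), Function.Surjective f ∧
      ∀ σ x, inclusion h (f σ x) = σ (inclusion h x) := by
  have := hM.isGalois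
  have : IsAbelianGalois F M := { is_comm.comm := (commGroupOfMulSelf hM.mul_self).mul_comm }
  have : IsAbelianGalois F K := .of_algHom (inclusion h)
  let := (inclusion h).toRingHom.toAlgebra
  have : IsScalarTower F K M := IsScalarTower.of_algebraMap_eq' (inclusion h).comp_algebraMap.symm
  exact ⟨inferInstance, AlgEquiv.restrictNormalHom K, AlgEquiv.restrictNormalHom_surjective M,
    fun σ x => AlgEquiv.restrictNormal_commutes σ K x⟩

theorem IsMultiquadratic.mono {K M : IntermediateField F E} (hM : IsMultiquadratic M)
    (h : K ≤ M) : IsMultiquadratic K := by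
  obtain ⟨hK, f, hf, -⟩ := exists_restrict_of_le hM h
  have := hM.finiteDimensional
  refine ⟨FiniteDimensional.of_injective (inclusion h).toLinearMap (inclusion h).injective, hK,
    fun σ => ?_⟩
  obtain ⟨τ, rfl⟩ := hf σ
  rw [← map_mul, hM.mul_self, map_one]

theorem IsMultiquadratic.exists_compl {K M : IntermediateField F E} (hM : IsMultiquadratic M)
    (h : K ≤ M) : ∃ L, K ⊓ L = ⊥ ∧ K ⊔ L = M := by
  have := hM.finiteDimensional
  have := hM.isGalois
  obtain ⟨L, hL⟩ := exists_isCompl_of_mul_self hM.mul_self (restrict h)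
  refine ⟨lift L, ?_, ?_⟩
  · rw [← lift_restrict h, ← lift_inf, hL.inf_eq_bot, lift_bot]
  · rw [← lift_restrict h, ← lift_sup, hL.sup_eq_top, lift_top]

theorem IsMultiquadratic.exists_finrank_eq {M : IntermediateField F E} (hM : IsMultiquadratic M) :
    ∃ r : ℕ, Nonempty ((M ≃ₐ[F] M) ≃* Multiplicative (Fin r → ZMod 2)) ∧
      Module.finrank F M = 2 ^ r := by
  have := hM.finiteDimensional
  have := hM.isGalois
  obtain ⟨r, ⟨e⟩⟩ := exists_mulEquiv_zmodTwo_of_mul_self hM.mul_self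
  refine ⟨r, ⟨e⟩, ?_⟩
  rw [← IsGalois.card_aut_eq_finrank, Nat.card_congr e.toEquiv]
  simp

theorem IsMultiquadratic.exists_section {K M : IntermediateField F E} (hM : IsMultiquadratic M)
    (h : K ≤ M) : ∃ s : (K ≃ₐ[F] K) →* (M ≃ₐ[F] M),
      ∀ σ x, s σ (inclusion h x) = inclusion h (σ x) := by
  obtain ⟨-, f, hf, hfx⟩ := exists_restrict_of_le hM h
  obtain ⟨s, hs⟩ := f.exists_rightInverse_of_mul_self hM.mul_self hf
  exact ⟨s, fun σ x => by rw [← hfx, hs]⟩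

/-- Between a nontrivial field `K` and a larger field `K'` inside a compositum of `n + 1` quadratic
fields, `K'` is the compositum of `K` and a linearly disjoint field of degree at most `2 ^ n`. -/
theorem exists_compl_finrank_le [CharZero F] [Normal F E] {K K' : IntermediateField F E}
    {S : Finset E} {n : ℕ} (hcard : S.card ≤ n + 1)
    (hS : ∀ x ∈ S, ∃ q : F, x ^ 2 = algebraMap F E q)
    (hK' : K' ≤ adjoin F (S : Set E)) (hlt : K < K') (hK : K ≠ ⊥) :
    ∃ (L : IntermediateField F E) (r : ℕ), 1 ≤ r ∧ r ≤ n ∧ K ⊓ L = ⊥ ∧ K ⊔ L = K' ∧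
      L < K' ∧ Nonempty ((L ≃ₐ[F] L) ≃* Multiplicative (Fin r → ZMod 2)) := by
  classical
  have hS' := isMultiquadratic_adjoin_sqrt S hS
  obtain ⟨L, hinf, hsup⟩ := (hS'.mono hK').exists_compl hlt.le
  have hL : L < K' := by
    refine lt_of_le_of_ne (hsup ▸ le_sup_right) ?_
    rintro rfl
    exact hK (inf_eq_left.2 hlt.le ▸ hinf)
  obtain ⟨r, hr, hrank⟩ := (hS'.mono (hL.le.trans hK')).exists_finrank_eq
  refine ⟨L, r, ?_, ?_, hinf, hsup, hL, hr⟩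
  · rw [Nat.one_le_iff_ne_zero]
    rintro rfl
    rw [pow_zero, IntermediateField.finrank_eq_one_iff] at hrank
    rw [hrank, sup_bot_eq] at hsup
    exact hlt.ne hsup
  · have := hS'.finiteDimensional
    -- L is a proper subfield of the compositum, so its degree is strictly below 2 ^ (n + 1); this
    -- saves one in the exponent.
    have hfin : Module.finrank F L < 2 ^ (n + 1) :=
      (lt_of_le_of_ne (finrank_le_of_le_right (hL.le.trans hK')) fun h =>
        (hL.trans_le hK').ne (eq_of_le_of_finrank_eq (hL.le.trans hK') h)).trans_le
      ((finrank_adjoin_sqrt_le S hS).2.trans (Nat.pow_le_pow_right two_pos hcard))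
    rw [hrank] at hfin
    exact Nat.lt_succ_iff.1 ((Nat.pow_lt_pow_iff_right one_lt_two).1 hfin)

end IntermediateField

/-! ### Division fields over ℚ and minimal base change -/

/-- Two ℚ-algebra structures on the closure are reconciled here: a ring carries at most one. -/
instance : Normal ℚ (AlgebraicClosure ℚ) := by
  convert (inferInstance : @Normal ℚ (AlgebraicClosure ℚ) _ _ (AlgebraicClosure.instAlgebra ℚ))
  exact Subsingleton.elim _ _

open IntermediateField in
theorem IntermediateField.IsMultiquadratic.isElementaryTwoExtension
    {M : IntermediateField ℚ (AlgebraicClosure ℚ)} (hM : IsMultiquadratic M) {r : ℕ}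
    (e : Nonempty ((@AlgEquiv ℚ M M _ _ _ M.algebra' M.algebra') ≃*
      Multiplicative (Fin r → ZMod 2))) (inst : Algebra ℚ M) :
    @IsElementaryTwoExtension M _ inst r := by
  obtain rfl : inst = M.algebra' := Subsingleton.elim _ _
  exact ⟨@NumberField.mk _ _ inferInstance hM.finiteDimensional, hM.isGalois, e⟩

open IntermediateField in
theorem IntermediateField.IsMultiquadratic.restrictionSplits
    {K M : IntermediateField ℚ (AlgebraicClosure ℚ)} (hM : IsMultiquadratic M) (h : K ≤ M) :
    RestrictionSplits K M := by
  suffices ∀ (a : Algebra ℚ K) (b : Algebra ℚ M), ∃ s : (K ≃ₐ[ℚ] K) →* (M ≃ₐ[ℚ] M),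
      ∀ σ x, s σ (inclusion h x) = inclusion h (σ x) from ⟨h, this _ _⟩
  intro a b
  obtain rfl : a = K.algebra' := Subsingleton.elim _ _
  obtain rfl : b = M.algebra' := Subsingleton.elim _ _
  exact hM.exists_section h

theorem restrictScalars_divisionField (E : WeierstrassCurve ℚ) (n : ℕ)
    (L : IntermediateField ℚ (AlgebraicClosure ℚ)) :
    (divisionField L E n).restrictScalars ℚ = L ⊔ divisionField ℚ E n :=
  Eq.trans (SetLike.ext fun _ => Iff.rfl) (IntermediateField.restrictScalars_adjoin_eq_sup ℚ L _)

open IntermediateField in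
/-- If the 8-division field lies in a compositum of few quadratic fields and differs from the
4-division field, which is nontrivial, then a minimal base change making the two fields
coincide exists. -/
theorem exists_minimalBaseChange {E : WeierstrassCurve ℚ} (S : Finset (AlgebraicClosure ℚ))
    (hcard : S.card ≤ 5) (hS : ∀ x ∈ S, ∃ q : ℚ, x ^ 2 = algebraMap ℚ _ q)
    (h8 : divisionField ℚ E 8 ≤ adjoin ℚ (S : Set (AlgebraicClosure ℚ)))
    (h48 : divisionField ℚ E 4 < divisionField ℚ E 8) (h4 : divisionField ℚ E 4 ≠ ⊥) :
    (∃ t : ℕ, IsElementaryTwoExtension (divisionField ℚ E 8) t) ∧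
      RestrictionSplits (divisionField ℚ E 4) (divisionField ℚ E 8) ∧
      ∃ (L : IntermediateField ℚ (AlgebraicClosure ℚ)) (r : ℕ),
        1 ≤ r ∧ r ≤ 4 ∧ IsElementaryTwoExtension L r ∧
        IsMinimalBaseChange E 4 8 L ∧
        divisionField L E 4 = divisionField L E 8 ∧
        divisionField L E 4 ≠ ⊥ := by
  have hK := (isMultiquadratic_adjoin_sqrt S hS).mono h8
  obtain ⟨t, ht, -⟩ := hK.exists_finrank_eq
  obtain ⟨L, r, hr1, hr4, hinf, hsup, hL, hr⟩ := exists_compl_finrank_le hcard hS h8 h48 h4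
  have h4L : (divisionField L E 4).restrictScalars ℚ = divisionField ℚ E 8 := by
    rw [restrictScalars_divisionField, sup_comm, hsup]
  have h8L : (divisionField L E 8).restrictScalars ℚ = divisionField ℚ E 8 := by
    rw [restrictScalars_divisionField, sup_eq_right.2 hL.le]
  refine ⟨⟨t, hK.isElementaryTwoExtension ht _⟩, hK.restrictionSplits h48.le, L, r, hr1, hr4,
    (hK.mono hL.le).isElementaryTwoExtension hr _, ⟨h4L, hinf⟩,
    restrictScalars_injective ℚ (h4L.trans h8L.symm), fun hbot => ?_⟩
  -- L(E[4]) = L would give L = ℚ(E[8]), but L is a proper subfield.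
  refine hL.ne (SetLike.ext fun x => ?_)
  rw [← h4L, mem_restrictScalars, hbot, mem_bot]
  exact ⟨fun hx => ⟨⟨x, hx⟩, rfl⟩, fun ⟨y, hy⟩ => hy ▸ y.2⟩

/-! ### Halving points when the 2-torsion is rational -/

namespace WeierstrassCurve

/-- The Weierstrass curve `y² = (x - e₁)(x - e₂)(x - e₃)`. -/
def ofRoots {R : Type*} [CommRing R] (e₁ e₂ e₃ : R) : WeierstrassCurve R :=
  ⟨0, -(e₁ + e₂ + e₃), 0, e₁ * e₂ + e₁ * e₃ + e₂ * e₃, -(e₁ * e₂ * e₃)⟩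

theorem baseChange_ofRoots {R A : Type*} [CommRing R] [CommRing A] [Algebra R A] (e₁ e₂ e₃ : R) :
    (ofRoots e₁ e₂ e₃).baseChange A =
      ofRoots (algebraMap R A e₁) (algebraMap R A e₂) (algebraMap R A e₃) := by
  ext <;> simp [ofRoots]

namespace ofRoots

open WeierstrassCurve.Affine

variable {k : Type*} [Field k] {e₁ e₂ e₃ x y u₁ u₂ u₃ : k}

theorem equation_iff : (ofRoots e₁ e₂ e₃).toAffine.Equation x y ↔
    y ^ 2 = (x - e₁) * (x - e₂) * (x - e₃) := by
  rw [Affine.equation_iff]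
  simp only [ofRoots]
  constructor <;> intro h <;> linear_combination h

theorem negY : (ofRoots e₁ e₂ e₃).toAffine.negY x y = -y := by
  simp [Affine.negY, ofRoots]

theorem nonsingular_of_ne_zero (h2 : (2 : k) ≠ 0)
    (h : y ^ 2 = (x - e₁) * (x - e₂) * (x - e₃)) (hy : y ≠ 0) :
    (ofRoots e₁ e₂ e₃).toAffine.Nonsingular x y := by
  refine (Affine.nonsingular_iff _ _).2 ⟨equation_iff.2 h, Or.inr fun h' => hy ?_⟩
  simp only [ofRoots] at h'
  have : 2 * y = 0 := by linear_combination h'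
  exact (mul_eq_zero.1 this).resolve_left h2

variable [DecidableEq k]

theorem two_nsmul_eq_zero_iff (h2 : (2 : k) ≠ 0)
    (h : (ofRoots e₁ e₂ e₃).toAffine.Nonsingular x y) :
    2 • Point.some x y h = 0 ↔ y = 0 := by
  rw [two_nsmul]
  constructor
  · intro h0
    by_contra hy
    refine Point.some_ne_zero _ ((Point.add_self_of_Y_ne (h₁ := h) ?_).symm.trans h0)
    rw [negY]
    intro h'
    have : 2 * y = 0 := by linear_combination h'
    exact hy ((mul_eq_zero.1 this).resolve_left h2)
  · rintro rfl
    exact Point.add_self_of_Y_eq (by rw [negY, neg_zero])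

/-- The half of the point `(x, u₁u₂u₃)` determined by square roots `uᵢ` of `x - eᵢ`. -/
theorem two_nsmul_eq (h2 : (2 : k) ≠ 0) (hu₂ : u₁ ^ 2 + e₁ = u₂ ^ 2 + e₂)
    (hu₃ : u₁ ^ 2 + e₁ = u₃ ^ 2 + e₃)
    (hx : x = e₁ + (u₁ + u₂) * (u₁ + u₃)) (hy : y = (u₁ + u₂) * (u₁ + u₃) * (u₂ + u₃))
    (hy0 : y ≠ 0) (h : (ofRoots e₁ e₂ e₃).toAffine.Nonsingular x y) :
    ∃ h', 2 • Point.some x y h = Point.some (u₁ ^ 2 + e₁) (u₁ * u₂ * u₃) h' := by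
  have hne : y ≠ (ofRoots e₁ e₂ e₃).toAffine.negY x y := by
    rw [negY]
    intro h'
    have : 2 * y = 0 := by linear_combination h'
    exact hy0 ((mul_eq_zero.1 this).resolve_left h2)
  obtain rfl : e₂ = u₁ ^ 2 + e₁ - u₂ ^ 2 := by linear_combination hu₂.symm
  obtain rfl : e₃ = u₁ ^ 2 + e₁ - u₃ ^ 2 := by linear_combination hu₃.symm
  -- The tangent at the half has slope u₁ + u₂ + u₃.
  have hs : (ofRoots e₁ (u₁ ^ 2 + e₁ - u₂ ^ 2) (u₁ ^ 2 + e₁ - u₃ ^ 2)).toAffine.slope x x y y =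
      u₁ + u₂ + u₃ := by
    rw [Affine.slope_of_Y_ne rfl hne, negY, div_eq_iff (by
      rw [sub_neg_eq_add, ← two_mul]; exact mul_ne_zero h2 hy0)]
    simp only [ofRoots, hx, hy]
    ring
  have hX : (ofRoots e₁ (u₁ ^ 2 + e₁ - u₂ ^ 2) (u₁ ^ 2 + e₁ - u₃ ^ 2)).toAffine.addX x x
      (u₁ + u₂ + u₃) = u₁ ^ 2 + e₁ := by
    simp only [Affine.addX, ofRoots, hx]
    ring
  have hY : (ofRoots e₁ (u₁ ^ 2 + e₁ - u₂ ^ 2) (u₁ ^ 2 + e₁ - u₃ ^ 2)).toAffine.addY x x y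
      (u₁ + u₂ + u₃) = u₁ * u₂ * u₃ := by
    simp only [Affine.addY, Affine.negAddY, hX, negY]
    rw [hx, hy]
    ring
  have key := Point.add_self_of_Y_ne (h₁ := h) hne
  simp only [hs, hX, hY] at key
  rw [two_nsmul]
  exact ⟨_, key⟩

/-- The halving formulas invert rationally. With tᵢ = x - eᵢ they read t₁ = (u₁ + u₂)(u₁ + u₃) and
cyclically, so uᵢ + uⱼ = tᵢtⱼ / y, and these three sums determine the uᵢ. -/
theorem exists_two_nsmul_eq (h2 : (2 : k) ≠ 0) (hy0 : y ≠ 0)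
    (h : (ofRoots e₁ e₂ e₃).toAffine.Nonsingular x y) :
    ∃ u₁ u₂ u₃ : k, u₁ ^ 2 + e₁ = u₂ ^ 2 + e₂ ∧ u₁ ^ 2 + e₁ = u₃ ^ 2 + e₃ ∧
      x = e₁ + (u₁ + u₂) * (u₁ + u₃) ∧ y = (u₁ + u₂) * (u₁ + u₃) * (u₂ + u₃) ∧
      ∃ h', 2 • Point.some x y h = Point.some (u₁ ^ 2 + e₁) (u₁ * u₂ * u₃) h' := by
  have heq := equation_iff.1 h.1
  obtain ⟨t₁, ht₁⟩ : ∃ t, t = x - e₁ := ⟨_, rfl⟩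
  obtain ⟨t₂, ht₂⟩ : ∃ t, t = x - e₂ := ⟨_, rfl⟩
  obtain ⟨t₃, ht₃⟩ : ∃ t, t = x - e₃ := ⟨_, rfl⟩
  rw [← ht₁, ← ht₂, ← ht₃] at heq
  obtain rfl : e₁ = x - t₁ := by rw [ht₁]; ring
  obtain rfl : e₂ = x - t₂ := by rw [ht₂]; ring
  obtain rfl : e₃ = x - t₃ := by rw [ht₃]; ring
  clear ht₁ ht₂ ht₃
  have h12 : (t₁ * t₂ + t₁ * t₃ - t₂ * t₃) / (2 * y) + (t₁ * t₂ + t₂ * t₃ - t₁ * t₃) / (2 * y) =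
      t₁ * t₂ / y := by field_simp; ring
  have h13 : (t₁ * t₂ + t₁ * t₃ - t₂ * t₃) / (2 * y) + (t₁ * t₃ + t₂ * t₃ - t₁ * t₂) / (2 * y) =
      t₁ * t₃ / y := by field_simp; ring
  have h23 : (t₁ * t₂ + t₂ * t₃ - t₁ * t₃) / (2 * y) + (t₁ * t₃ + t₂ * t₃ - t₁ * t₂) / (2 * y) =
      t₂ * t₃ / y := by field_simp; ring
  have e2 : ((t₁ * t₂ + t₁ * t₃ - t₂ * t₃) / (2 * y)) ^ 2 + (x - t₁) =
      ((t₁ * t₂ + t₂ * t₃ - t₁ * t₃) / (2 * y)) ^ 2 + (x - t₂) := by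
    field_simp
    linear_combination 4 * (t₂ - t₁) * heq
  have e3 : ((t₁ * t₂ + t₁ * t₃ - t₂ * t₃) / (2 * y)) ^ 2 + (x - t₁) =
      ((t₁ * t₃ + t₂ * t₃ - t₁ * t₂) / (2 * y)) ^ 2 + (x - t₃) := by
    field_simp
    linear_combination 4 * (t₃ - t₁) * heq
  have hx : x = x - t₁ + t₁ * t₂ / y * (t₁ * t₃ / y) := by
    field_simp
    linear_combination t₁ * heq
  have hy : y = t₁ * t₂ / y * (t₁ * t₃ / y) * (t₂ * t₃ / y) := by
    field_simp
    linear_combination (y ^ 2 + t₁ * t₂ * t₃) * heq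
  rw [← h12, ← h13] at hx
  rw [← h12, ← h13, ← h23] at hy
  exact ⟨_, _, _, e2, e3, hx, hy, two_nsmul_eq h2 e2 e3 hx hy hy0 h⟩

theorem four_nsmul_eq_zero (h2 : (2 : k) ≠ 0)
    (h : (ofRoots e₁ e₂ e₃).toAffine.Nonsingular x y) (h4 : 4 • Point.some x y h = 0) :
    y = 0 ∨ ∃ u₁ u₂ u₃ : k, u₁ ^ 2 + e₁ = u₂ ^ 2 + e₂ ∧ u₁ ^ 2 + e₁ = u₃ ^ 2 + e₃ ∧
      x = e₁ + (u₁ + u₂) * (u₁ + u₃) ∧ y = (u₁ + u₂) * (u₁ + u₃) * (u₂ + u₃) ∧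
      u₁ * u₂ * u₃ = 0 := by
  refine or_iff_not_imp_left.2 fun hy0 => ?_
  obtain ⟨u₁, u₂, u₃, hu₂, hu₃, hx, hy, h', hP⟩ := exists_two_nsmul_eq h2 hy0 h
  refine ⟨u₁, u₂, u₃, hu₂, hu₃, hx, hy, (two_nsmul_eq_zero_iff h2 h').1 ?_⟩
  rw [← hP, ← mul_nsmul, h4]

theorem eight_nsmul_eq_zero (h2 : (2 : k) ≠ 0)
    (h : (ofRoots e₁ e₂ e₃).toAffine.Nonsingular x y) (h8 : 8 • Point.some x y h = 0) :
    y = 0 ∨ ∃ u₁ u₂ u₃ : k, u₁ ^ 2 + e₁ = u₂ ^ 2 + e₂ ∧ u₁ ^ 2 + e₁ = u₃ ^ 2 + e₃ ∧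
      x = e₁ + (u₁ + u₂) * (u₁ + u₃) ∧ y = (u₁ + u₂) * (u₁ + u₃) * (u₂ + u₃) ∧
      ∃ h' : (ofRoots e₁ e₂ e₃).toAffine.Nonsingular (u₁ ^ 2 + e₁) (u₁ * u₂ * u₃),
        4 • Point.some _ _ h' = 0 := by
  refine or_iff_not_imp_left.2 fun hy0 => ?_
  obtain ⟨u₁, u₂, u₃, hu₂, hu₃, hx, hy, h', hP⟩ := exists_two_nsmul_eq h2 hy0 h
  exact ⟨u₁, u₂, u₃, hu₂, hu₃, hx, hy, h', by rw [← hP, ← mul_nsmul, h8]⟩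

theorem exists_half (h2 : (2 : k) ≠ 0) (h₁₂ : e₁ ≠ e₂) (h₁₃ : e₁ ≠ e₃) (h₂₃ : e₂ ≠ e₃)
    (hu₂ : u₁ ^ 2 + e₁ = u₂ ^ 2 + e₂) (hu₃ : u₁ ^ 2 + e₁ = u₃ ^ 2 + e₃) :
    ∃ h h', 2 • Point.some (e₁ + (u₁ + u₂) * (u₁ + u₃)) ((u₁ + u₂) * (u₁ + u₃) * (u₂ + u₃)) h =
      (Point.some (u₁ ^ 2 + e₁) (u₁ * u₂ * u₃) h' : (ofRoots e₁ e₂ e₃).toAffine.Point) := by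
  -- (uᵢ + uⱼ)(uᵢ - uⱼ) = eⱼ - eᵢ is nonzero, hence so is each factor.
  have hy0 : (u₁ + u₂) * (u₁ + u₃) * (u₂ + u₃) ≠ 0 := by
    refine mul_ne_zero (mul_ne_zero (fun h => h₁₂ ?_) (fun h => h₁₃ ?_)) (fun h => h₂₃ ?_)
    · linear_combination hu₂ - (u₁ - u₂) * h
    · linear_combination hu₃ - (u₁ - u₃) * h
    · linear_combination hu₃ - hu₂ - (u₂ - u₃) * h
  have hns := nonsingular_of_ne_zero (e₁ := e₁) (e₂ := e₂) (e₃ := e₃) (k := k)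
    (x := e₁ + (u₁ + u₂) * (u₁ + u₃)) h2 (by
      obtain rfl : e₂ = u₁ ^ 2 + e₁ - u₂ ^ 2 := by linear_combination hu₂.symm
      obtain rfl : e₃ = u₁ ^ 2 + e₁ - u₃ ^ 2 := by linear_combination hu₃.symm
      ring) hy0
  exact ⟨hns, two_nsmul_eq h2 hu₂ hu₃ rfl rfl hy0 hns⟩

end ofRoots

end WeierstrassCurve

open WeierstrassCurve in
theorem mem_torsionCoordinates_ofRoots {e₁ e₂ e₃ : ℚ} {a₁ a₂ a₃ : AlgebraicClosure ℚ}
    (h₁ : algebraMap ℚ _ e₁ = a₁) (h₂ : algebraMap ℚ _ e₂ = a₂) (h₃ : algebraMap ℚ _ e₃ = a₃)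
    {n : ℕ} {z : AlgebraicClosure ℚ} :
    z ∈ torsionCoordinates (ofRoots e₁ e₂ e₃) n ↔
      ∃ (x y : AlgebraicClosure ℚ) (h : (ofRoots a₁ a₂ a₃).toAffine.Nonsingular x y),
        letI := Classical.decEq (AlgebraicClosure ℚ)
        n • Affine.Point.some x y h = 0 ∧ (z = x ∨ z = y) := by
  subst h₁ h₂ h₃
  rw [← baseChange_ofRoots]
  exact Iff.rfl

/-! ### The twisted family: upper bounds for the division fields -/

/-- The quadratic twist by `d` of the curve `y² = x(x + 9)(x + 25)`. -/
def twistedCurve (d : ℚ) : WeierstrassCurve ℚ := .ofRoots 0 (-(9 * d)) (-(25 * d))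

namespace twistedCurve

open WeierstrassCurve WeierstrassCurve.ofRoots

section Upper

variable {k : Type*} [Field k] {x y : k}

theorem eq_root_of_Y_eq_zero {e₁ e₂ e₃ : k} (h : (ofRoots e₁ e₂ e₃).toAffine.Equation x y)
    (hy : y = 0) : x = e₁ ∨ x = e₂ ∨ x = e₃ := by
  have h := equation_iff.1 h
  rw [hy, zero_pow two_ne_zero, eq_comm, mul_eq_zero, mul_eq_zero, sub_eq_zero, sub_eq_zero,
    sub_eq_zero, or_assoc] at h
  exact h

variable {F : Type*} [Field F] [Algebra F k] {K : IntermediateField F k} {i s D u₁ u₂ u₃ : k}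

theorem mem_of_sq_eq_sq {u v : k} (hv : v ∈ K) (h : u ^ 2 = v ^ 2) : u ∈ K := by
  rcases sq_eq_sq_iff_eq_or_eq_neg.1 h with rfl | rfl
  exacts [hv, neg_mem hv]

theorem mem_of_roots {e₁ : k} (he : e₁ ∈ K) (h₁ : u₁ ∈ K) (h₂ : u₂ ∈ K) (h₃ : u₃ ∈ K)
    (hx : x = e₁ + (u₁ + u₂) * (u₁ + u₃)) (hy : y = (u₁ + u₂) * (u₁ + u₃) * (u₂ + u₃)) :
    x ∈ K ∧ y ∈ K := by
  subst hx hy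
  exact ⟨add_mem he (mul_mem (add_mem h₁ h₂) (add_mem h₁ h₃)),
    mul_mem (mul_mem (add_mem h₁ h₂) (add_mem h₁ h₃)) (add_mem h₂ h₃)⟩

variable [CharZero k] [DecidableEq k]

/-- Some uᵢ vanishes, and then the other two are square roots of differences of roots, namely ±9D,
±16D or ±25D, which lie in K. -/
theorem mem_of_four_nsmul_eq_zero (hi : i ^ 2 = -1) (hs : s ^ 2 = D) (hiK : i ∈ K) (hsK : s ∈ K)
    (h : (ofRoots 0 (-(9 * D)) (-(25 * D))).toAffine.Nonsingular x y)
    (h4 : 4 • Affine.Point.some x y h = 0) : x ∈ K ∧ y ∈ K := by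
  have hD : D ∈ K := hs ▸ pow_mem hsK 2
  have n (m : ℕ) [m.AtLeastTwo] : (OfNat.ofNat m : k) ∈ K := ofNat_mem K m
  rcases four_nsmul_eq_zero two_ne_zero h h4 with hy | ⟨u₁, u₂, u₃, hu₂, hu₃, hx, hy, h0⟩
  · refine ⟨?_, hy ▸ zero_mem K⟩
    rcases eq_root_of_Y_eq_zero h.1 hy with rfl | rfl | rfl
    exacts [zero_mem K, neg_mem (mul_mem (n 9) hD), neg_mem (mul_mem (n 25) hD)]
  · subst hs
    rcases mul_eq_zero.1 h0 with h0 | rfl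
    · rcases mul_eq_zero.1 h0 with rfl | rfl
      · exact mem_of_roots (zero_mem K) (zero_mem K)
          (mem_of_sq_eq_sq (mul_mem (n 3) hsK) (by linear_combination -hu₂))
          (mem_of_sq_eq_sq (mul_mem (n 5) hsK) (by linear_combination -hu₃)) hx hy
      · exact mem_of_roots (zero_mem K)
          (mem_of_sq_eq_sq (mul_mem (mul_mem (n 3) hiK) hsK)
            (by linear_combination hu₂ - 9 * s ^ 2 * hi)) (zero_mem K)
          (mem_of_sq_eq_sq (mul_mem (n 4) hsK) (by linear_combination hu₂ - hu₃)) hx hy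
    · exact mem_of_roots (zero_mem K)
        (mem_of_sq_eq_sq (mul_mem (mul_mem (n 5) hiK) hsK)
          (by linear_combination hu₃ - 25 * s ^ 2 * hi))
        (mem_of_sq_eq_sq (mul_mem (mul_mem (n 4) hiK) hsK)
          (by linear_combination hu₃ - hu₂ - 16 * s ^ 2 * hi)) (zero_mem K) hx hy

variable {r₂ r₃ r₅ : k}

theorem exists_sqrt_of_four_nsmul_eq_zero (hi : i ^ 2 = -1) (hs : s ^ 2 = D) (hr₂ : r₂ ^ 2 = 2)
    (hr₃ : r₃ ^ 2 = 3) (hr₅ : r₅ ^ 2 = 5) (hiK : i ∈ K) (hsK : s ∈ K) (hr₂K : r₂ ∈ K)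
    (hr₃K : r₃ ∈ K) (hr₅K : r₅ ∈ K)
    (h : (ofRoots 0 (-(9 * D)) (-(25 * D))).toAffine.Nonsingular x y)
    (h4 : 4 • Affine.Point.some x y h = 0) :
    ∃ v₁ ∈ K, ∃ v₂ ∈ K, ∃ v₃ ∈ K, x = v₁ ^ 2 ∧ x = v₂ ^ 2 - 9 * D ∧ x = v₃ ^ 2 - 25 * D := by
  have n (m : ℕ) [m.AtLeastTwo] : (OfNat.ofNat m : k) ∈ K := ofNat_mem K m
  have hi4 : i ^ 4 = 1 := by linear_combination (i ^ 2 - 1) * hi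
  subst hs
  rcases four_nsmul_eq_zero two_ne_zero h h4 with hy | ⟨u₁, u₂, u₃, hu₂, hu₃, hx, hy, h0⟩
  · rcases eq_root_of_Y_eq_zero h.1 hy with rfl | rfl | rfl
    · exact ⟨0, zero_mem K, 3 * s, mul_mem (n 3) hsK, 5 * s, mul_mem (n 5) hsK, by ring, by ring,
        by ring⟩
    · exact ⟨3 * i * s, mul_mem (mul_mem (n 3) hiK) hsK, 0, zero_mem K, 4 * s, mul_mem (n 4) hsK,
        by linear_combination -9 * s ^ 2 * hi, by ring, by ring⟩
    · exact ⟨5 * i * s, mul_mem (mul_mem (n 5) hiK) hsK, 4 * i * s,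
        mul_mem (mul_mem (n 4) hiK) hsK, 0, zero_mem K,
        by linear_combination -25 * s ^ 2 * hi, by linear_combination -16 * s ^ 2 * hi, by ring⟩
  · rcases mul_eq_zero.1 h0 with h0 | rfl
    · rcases mul_eq_zero.1 h0 with rfl | rfl
      · have hw : (u₂ * u₃) ^ 2 = (15 * s ^ 2) ^ 2 := by
          linear_combination -u₂ ^ 2 * hu₃ - 25 * s ^ 2 * hu₂
        rcases sq_eq_sq_iff_eq_or_eq_neg.1 hw with hw | hw
        · refine ⟨r₃ * r₅ * s, mul_mem (mul_mem hr₃K hr₅K) hsK,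
            2 * r₂ * r₃ * s, mul_mem (mul_mem (mul_mem (n 2) hr₂K) hr₃K) hsK,
            2 * r₂ * r₅ * s, mul_mem (mul_mem (mul_mem (n 2) hr₂K) hr₅K) hsK, ?_, ?_, ?_⟩ <;>
          · simp only [mul_pow, hr₂, hr₃, hr₅]
            linear_combination hx + hw
        · refine ⟨i * r₃ * r₅ * s, mul_mem (mul_mem (mul_mem hiK hr₃K) hr₅K) hsK,
            i * r₂ * r₃ * s, mul_mem (mul_mem (mul_mem hiK hr₂K) hr₃K) hsK,
            r₂ * r₅ * s, mul_mem (mul_mem hr₂K hr₅K) hsK, ?_, ?_, ?_⟩ <;>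
          · simp only [mul_pow, hi, hr₂, hr₃, hr₅]
            linear_combination hx + hw
      · have hw : (u₁ * u₃) ^ 2 = (12 * i * s ^ 2) ^ 2 := by
          have h1 : u₁ ^ 2 = -(9 * s ^ 2) := by linear_combination hu₂
          have h3 : u₃ ^ 2 = 16 * s ^ 2 := by linear_combination hu₂ - hu₃
          simp only [mul_pow, h1, h3, hi]
          ring
        have h1 : u₁ ^ 2 = -(9 * s ^ 2) := by linear_combination hu₂
        -- The sign of u₁u₃ is absorbed into j = ±i. The witnesses then come from -9 + 12j = 3(1 +
        -- 2j)², 12j = 6(1 + j)² and 16 + 12j = 2(3 + j)².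
        have hcase : ∃ j ∈ K, j ^ 2 = -1 ∧ u₁ * u₃ = 12 * j * s ^ 2 := by
          rcases sq_eq_sq_iff_eq_or_eq_neg.1 hw with hw | hw
          · exact ⟨i, hiK, hi, hw⟩
          · exact ⟨-i, neg_mem hiK, by rw [neg_sq, hi], by rw [hw]; ring⟩
        obtain ⟨j, hjK, hj, hw⟩ := hcase
        refine ⟨r₃ * s * (1 + 2 * j),
          mul_mem (mul_mem hr₃K hsK) (add_mem (one_mem K) (mul_mem (n 2) hjK)),
          r₂ * r₃ * s * (1 + j),
          mul_mem (mul_mem (mul_mem hr₂K hr₃K) hsK) (add_mem (one_mem K) hjK),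
          r₂ * s * (3 + j), mul_mem (mul_mem hr₂K hsK) (add_mem (n 3) hjK), ?_, ?_, ?_⟩
        · simp only [mul_pow, hr₃]
          linear_combination hx + hw + h1 - 12 * s ^ 2 * hj
        · simp only [mul_pow, hr₂, hr₃]
          linear_combination hx + hw + h1 - 6 * s ^ 2 * hj
        · simp only [mul_pow, hr₂]
          linear_combination hx + hw + h1 - 2 * s ^ 2 * hj
    · have h1 : u₁ ^ 2 = -(25 * s ^ 2) := by linear_combination hu₃
      have h2 : u₂ ^ 2 = -(16 * s ^ 2) := by linear_combination hu₃ - hu₂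
      -- Here x = -25D ± 20D, giving the triples -5D, 4D, 20D and -45D, -36D, -20D.
      have hw : (u₁ * u₂) ^ 2 = (20 * s ^ 2) ^ 2 := by
        rw [mul_pow, h1, h2]
        ring
      rcases sq_eq_sq_iff_eq_or_eq_neg.1 hw with hw | hw
      · refine ⟨i * r₅ * s, mul_mem (mul_mem hiK hr₅K) hsK, 2 * s, mul_mem (n 2) hsK,
          2 * r₅ * s, mul_mem (mul_mem (n 2) hr₅K) hsK, ?_, ?_, ?_⟩ <;>
        · simp only [mul_pow, hi, hr₅]
          linear_combination hx + hw + h1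
      · refine ⟨3 * i * r₅ * s, mul_mem (mul_mem (mul_mem (n 3) hiK) hr₅K) hsK,
          6 * i * s, mul_mem (mul_mem (n 6) hiK) hsK,
          2 * i * r₅ * s, mul_mem (mul_mem (mul_mem (n 2) hiK) hr₅K) hsK, ?_, ?_, ?_⟩ <;>
        · simp only [mul_pow, hi, hr₅]
          linear_combination hx + hw + h1

/-- The uᵢ attached to P are square roots of x(2P) - eᵢ, and 2P is 4-torsion, so the preceding lemma
puts them in K. -/
theorem mem_of_eight_nsmul_eq_zero (hi : i ^ 2 = -1) (hs : s ^ 2 = D) (hr₂ : r₂ ^ 2 = 2)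
    (hr₃ : r₃ ^ 2 = 3) (hr₅ : r₅ ^ 2 = 5) (hiK : i ∈ K) (hsK : s ∈ K) (hr₂K : r₂ ∈ K)
    (hr₃K : r₃ ∈ K) (hr₅K : r₅ ∈ K)
    (h : (ofRoots 0 (-(9 * D)) (-(25 * D))).toAffine.Nonsingular x y)
    (h8 : 8 • Affine.Point.some x y h = 0) : x ∈ K ∧ y ∈ K := by
  rcases eight_nsmul_eq_zero two_ne_zero h h8 with hy | ⟨u₁, u₂, u₃, hu₂, hu₃, hx, hy, h', h4⟩
  · refine mem_of_four_nsmul_eq_zero hi hs hiK hsK h ?_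
    rw [show 4 = 2 * 2 from rfl, mul_nsmul, (two_nsmul_eq_zero_iff two_ne_zero h).2 hy, nsmul_zero]
  · obtain ⟨v₁, hv₁, v₂, hv₂, v₃, hv₃, h₁, h₂, h₃⟩ :=
      exists_sqrt_of_four_nsmul_eq_zero hi hs hr₂ hr₃ hr₅ hiK hsK hr₂K hr₃K hr₅K h' h4
    exact mem_of_roots (zero_mem K)
      (mem_of_sq_eq_sq hv₁ (by linear_combination h₁))
      (mem_of_sq_eq_sq hv₂ (by linear_combination h₂ - hu₂))
      (mem_of_sq_eq_sq hv₃ (by linear_combination h₃ - hu₃)) hx hy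

end Upper

end twistedCurve

/-! ### Square roots of rationals in ℚ(i, √d) -/

namespace IntermediateField

variable {F E : Type*} [Field F] [Field E] [Algebra F E]

theorem exists_eq_add_mul_of_mem_adjoin_sqrt {x t : E} {q : F} (hx : x ^ 2 = algebraMap F E q)
    (ht : t ∈ F⟮x⟯) : ∃ a b : F, t = algebraMap F E a + algebraMap F E b * x := by
  have hint : IsIntegral F x := ⟨Polynomial.X ^ 2 - Polynomial.C q,
    Polynomial.monic_X_pow_sub_C q two_ne_zero, by simp [hx]⟩
  rw [← mem_toSubalgebra, adjoin_simple_toSubalgebra_of_isAlgebraic hint.isAlgebraic] at ht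
  induction ht using Algebra.adjoin_induction with
  | mem y hy => exact ⟨0, 1, by rw [Set.mem_singleton_iff.1 hy]; simp⟩
  | algebraMap r => exact ⟨r, 0, by simp⟩
  | add y z _ _ hy hz =>
    obtain ⟨a, b, rfl⟩ := hy
    obtain ⟨a', b', rfl⟩ := hz
    exact ⟨a + a', b + b', by simp only [map_add]; ring⟩
  | mul y z _ _ hy hz =>
    obtain ⟨a, b, rfl⟩ := hy
    obtain ⟨a', b', rfl⟩ := hz
    exact ⟨a * a' + b * b' * q, a * b' + b * a', by
      simp only [map_add, map_mul]
      linear_combination algebraMap F E b * algebraMap F E b' * hx⟩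

/-- Squaring t = a + bx gives 2abx = r - a² - b²q. Either ab = 0, or x, and with it t, lies in F. -/
theorem mem_range_or_mul_mem_range_of_mem_adjoin_sqrt [CharZero F] {x t : E} {q r : F}
    (hx : x ^ 2 = algebraMap F E q) (hr : t ^ 2 = algebraMap F E r) (ht : t ∈ F⟮x⟯) :
    (∃ c, algebraMap F E c = t) ∨ ∃ c, algebraMap F E c = x * t := by
  obtain ⟨a, b, rfl⟩ := exists_eq_add_mul_of_mem_adjoin_sqrt hx ht
  have key : algebraMap F E (2 * a * b) * x = algebraMap F E (r - a ^ 2 - b ^ 2 * q) := by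
    simp only [map_sub, map_mul, map_pow, map_ofNat]
    linear_combination hr - algebraMap F E b ^ 2 * hx
  by_cases hb : b = 0
  · exact Or.inl ⟨a, by simp [hb]⟩
  by_cases ha : a = 0
  · refine Or.inr ⟨b * q, ?_⟩
    simp only [ha, map_mul, map_zero]
    linear_combination -algebraMap F E b * hx
  · have h0 : 2 * a * b ≠ 0 := mul_ne_zero (mul_ne_zero two_ne_zero ha) hb
    refine Or.inl ⟨a + b * ((r - a ^ 2 - b ^ 2 * q) / (2 * a * b)), ?_⟩
    rw [map_add, map_mul, map_div₀, ← key, mul_div_cancel_left₀]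
    rwa [Ne, map_eq_zero]

/-- An element of `ℚ(i, √d)` whose square is rational has, up to sign and up to the factor `d`,
the square of a rational as its square. -/
theorem exists_sq_of_mem_adjoin_pair {E : Type*} [Field E] [Algebra ℚ E] {i s t : E} {d r : ℚ}
    (hi : i ^ 2 = -1) (hs : s ^ 2 = algebraMap ℚ E d) (hr : t ^ 2 = algebraMap ℚ E r)
    (ht : t ∈ adjoin ℚ {i, s}) : ∃ c : ℚ, c ^ 2 = r ∨ c ^ 2 = -r ∨ c ^ 2 = d * r ∨
      c ^ 2 = -(d * r) := by
  have hi' : i ^ 2 = algebraMap ℚ E (-1) := by rw [hi, map_neg, map_one]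
  have step : ∀ {t : E} {r : ℚ}, t ^ 2 = algebraMap ℚ E r → t ∈ ℚ⟮i⟯ →
      ∃ c : ℚ, c ^ 2 = r ∨ c ^ 2 = -r := by
    intro t r hr ht
    rcases mem_range_or_mul_mem_range_of_mem_adjoin_sqrt hi' hr ht with ⟨c, hc⟩ | ⟨c, hc⟩
    · exact ⟨c, Or.inl ((algebraMap ℚ E).injective (by rw [map_pow, hc, hr]))⟩
    · exact ⟨c, Or.inr ((algebraMap ℚ E).injective (by
        rw [map_pow, hc, mul_pow, hr, hi, map_neg, neg_one_mul]))⟩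
  -- The dichotomy over ℚ(i) puts t or st in ℚ(i); `step` then descends to ℚ.
  rw [Set.insert_eq, ← adjoin_adjoin_left, mem_restrictScalars] at ht
  rcases mem_range_or_mul_mem_range_of_mem_adjoin_sqrt (F := ℚ⟮i⟯)
    (q := ⟨_, algebraMap_mem _ d⟩) (r := ⟨_, algebraMap_mem _ r⟩) hs hr ht with ⟨c, hc⟩ | ⟨c, hc⟩
  · obtain ⟨c, h | h⟩ := step hr (hc ▸ c.2)
    exacts [⟨c, Or.inl h⟩, ⟨c, Or.inr (Or.inl h)⟩]
  · obtain ⟨c, h | h⟩ := step (t := s * t) (r := d * r) (by rw [mul_pow, hs, hr, map_mul])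
      (hc ▸ c.2)
    exacts [⟨c, Or.inr (Or.inr (Or.inl h))⟩, ⟨c, Or.inr (Or.inr (Or.inr h))⟩]

end IntermediateField

/-- If 10p = m² then m = pc and 10 = pc²; as 10 is squarefree, p = 10, which is not prime. -/
theorem Nat.Prime.not_isSquare_ten_mul {p : ℕ} (hp : p.Prime) : ¬IsSquare (10 * p) := by
  rintro ⟨m, hm⟩
  have hpm : p ∣ m := by
    have : p ∣ m * m := hm ▸ Dvd.intro_left 10 rfl
    exact (hp.dvd_mul.1 this).elim id id
  obtain ⟨c, rfl⟩ := hpm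
  have h10 : 10 = p * (c * c) := Nat.eq_of_mul_eq_mul_right hp.pos (by linarith)
  have hc : c ≤ 3 := by
    by_contra! h
    nlinarith [hp.pos, Nat.mul_le_mul h.le h.le]
  have hp2 := hp.two_le
  interval_cases c
  · omega
  · obtain rfl : p = 10 := by omega
    exact absurd hp (by norm_num)
  · omega
  · omega

/-! ### Isomorphism classes of the twists -/

namespace twistedCurve

open WeierstrassCurve WeierstrassCurve.ofRoots

theorem isElliptic {d : ℚ} (hd : d ≠ 0) : (twistedCurve d).IsElliptic := by
  refine ⟨isUnit_iff_ne_zero.2 ?_⟩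
  have : (twistedCurve d).Δ = 16 * (9 * 16 * 25) ^ 2 * d ^ 6 := by
    simp only [twistedCurve, ofRoots, Δ, b₂, b₄, b₆, b₈]
    ring
  rw [this]
  positivity

theorem c₄_eq (d : ℚ) : (twistedCurve d).c₄ = 7696 * d ^ 2 := by
  simp only [twistedCurve, ofRoots, c₄, b₂, b₄]
  ring

theorem c₆_eq (d : ℚ) : (twistedCurve d).c₆ = -312256 * d ^ 3 := by
  simp only [twistedCurve, ofRoots, c₆, b₂, b₄, b₆]
  ring

/-- A change of variables scales c₄ by v⁴ and c₆ by v⁶. Both are nonzero on the family, so dividing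
the two relations gives d' = v²d. -/
theorem isSquare_mul_of_smul_eq {d d' : ℚ} (hd : d ≠ 0)
    {C : VariableChange ℚ} (h : C • twistedCurve d = twistedCurve d') : IsSquare (d * d') := by
  have h4 := congrArg c₄ h
  have h6 := congrArg c₆ h
  rw [variableChange_c₄, c₄_eq, c₄_eq] at h4
  rw [variableChange_c₆, c₆_eq, c₆_eq] at h6
  set v : ℚ := ((C.u⁻¹ : ℚˣ) : ℚ)
  have hv : v ≠ 0 := Units.ne_zero _
  have h2 : d' ^ 2 = v ^ 4 * d ^ 2 := by linarith
  have h3 : d' ^ 3 = v ^ 6 * d ^ 3 := by linarith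
  have hd' : d' = v ^ 2 * d := by
    have : v ^ 4 * d ^ 2 ≠ 0 := by positivity
    refine mul_left_cancel₀ this ?_
    linear_combination h3 - d' * h2
  exact ⟨v * d, by rw [hd']; ring⟩

theorem mk_injective_on_primes :
    Function.Injective fun p : Nat.Primes => (Quotient.mk'' (twistedCurve (p : ℕ)) : CurveClass) := by
  rintro ⟨p, hp⟩ ⟨q, hq⟩ h
  obtain ⟨C, hC⟩ := MulAction.orbitRel_apply.1 (Quotient.exact h)
  have hsq := isSquare_mul_of_smul_eq (Nat.cast_ne_zero.2 hq.ne_zero) hC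
  rw [← Nat.cast_mul, Rat.isSquare_natCast_iff] at hsq
  obtain ⟨m, hm⟩ := hsq
  obtain ⟨c, rfl⟩ : q ∣ m := (hq.dvd_mul.1 (hm ▸ Dvd.intro _ rfl : q ∣ m * m)).elim id id
  have : p = q * (c * c) := Nat.eq_of_mul_eq_mul_left hq.pos (by linarith)
  exact Subtype.ext ((Nat.prime_dvd_prime_iff_eq hq hp).1 (Dvd.intro _ this.symm)).symm

/-! ### Bounds for the division fields inside the algebraic closure of ℚ -/

variable {d : ℚ} {i s r₂ r₃ r₅ : AlgebraicClosure ℚ}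

local notation "Ω" => AlgebraicClosure ℚ

theorem mem_torsionCoordinates {n : ℕ} {z : Ω} :
    z ∈ torsionCoordinates (twistedCurve d) n ↔
      ∃ (x y : Ω) (h : (ofRoots 0 (-(9 * algebraMap ℚ Ω d))
          (-(25 * algebraMap ℚ Ω d))).toAffine.Nonsingular x y),
        letI := Classical.decEq Ω
        n • Affine.Point.some x y h = 0 ∧ (z = x ∨ z = y) :=
  mem_torsionCoordinates_ofRoots (map_zero _) (by simp) (by simp)

theorem divisionField_four_le (hi : i ^ 2 = -1) (hs : s ^ 2 = algebraMap ℚ Ω d) :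
    divisionField ℚ (twistedCurve d) 4 ≤ IntermediateField.adjoin ℚ {i, s} := by
  classical
  refine IntermediateField.adjoin_le_iff.2 fun z hz => ?_
  obtain ⟨x, y, h, h4, hz⟩ := mem_torsionCoordinates.1 hz
  have := mem_of_four_nsmul_eq_zero (K := IntermediateField.adjoin ℚ {i, s}) hi hs
    (IntermediateField.subset_adjoin _ _ (by simp))
    (IntermediateField.subset_adjoin _ _ (by simp)) h h4
  rcases hz with rfl | rfl
  exacts [this.1, this.2]

theorem divisionField_eight_le (hi : i ^ 2 = -1) (hs : s ^ 2 = algebraMap ℚ Ω d)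
    (hr₂ : r₂ ^ 2 = 2) (hr₃ : r₃ ^ 2 = 3) (hr₅ : r₅ ^ 2 = 5) :
    divisionField ℚ (twistedCurve d) 8 ≤ IntermediateField.adjoin ℚ {i, r₂, r₃, r₅, s} := by
  classical
  refine IntermediateField.adjoin_le_iff.2 fun z hz => ?_
  obtain ⟨x, y, h, h8, hz⟩ := mem_torsionCoordinates.1 hz
  have := mem_of_eight_nsmul_eq_zero (K := IntermediateField.adjoin ℚ {i, r₂, r₃, r₅, s})
    hi hs hr₂ hr₃ hr₅
    (IntermediateField.subset_adjoin _ _ (by simp))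
    (IntermediateField.subset_adjoin _ _ (by simp))
    (IntermediateField.subset_adjoin _ _ (by simp))
    (IntermediateField.subset_adjoin _ _ (by simp))
    (IntermediateField.subset_adjoin _ _ (by simp)) h h8
  rcases hz with rfl | rfl
  exacts [this.1, this.2]

theorem divisionField_four_le_eight (E : WeierstrassCurve ℚ) :
    divisionField ℚ E 4 ≤ divisionField ℚ E 8 := by
  classical
  refine IntermediateField.adjoin.mono _ _ _ ?_
  rintro z ⟨x, y, h, h4, hz⟩
  exact ⟨x, y, h, (mul_nsmul _ 4 2).trans (by rw [h4, nsmul_zero]), hz⟩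

theorem roots_ne {D : Ω} (hD : D ≠ 0) : (0 : Ω) ≠ -(9 * D) ∧ (0 : Ω) ≠ -(25 * D) ∧
    -(9 * D) ≠ -(25 * D) := by
  refine ⟨fun h => hD ?_, fun h => hD ?_, fun h => hD ?_⟩
  · linear_combination h / 9
  · linear_combination h / 25
  · linear_combination h / 16

/-- Halving (-9d, 0) with u = (3is, 0, 4s) gives a 4-torsion point with x = (-9 + 12i)d, from which
i is recovered. -/
theorem mem_divisionField_four (hd : d ≠ 0) (hi : i ^ 2 = -1) (hs : s ^ 2 = algebraMap ℚ Ω d) :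
    i ∈ divisionField ℚ (twistedCurve d) 4 := by
  classical
  have hD : algebraMap ℚ Ω d ≠ 0 := by rwa [Ne, map_eq_zero]
  obtain ⟨h₁₂, h₁₃, h₂₃⟩ := roots_ne hD
  obtain ⟨h, h', hP⟩ := exists_half (u₁ := 3 * i * s) (u₂ := 0) (u₃ := 4 * s) two_ne_zero
    h₁₂ h₁₃ h₂₃ (by rw [← hs]; linear_combination 9 * s ^ 2 * hi)
    (by rw [← hs]; linear_combination 9 * s ^ 2 * hi)
  have hx := IntermediateField.subset_adjoin ℚ _ (mem_torsionCoordinates.2 ⟨_, _, h, by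
    rw [show 4 = 2 * 2 from rfl, mul_nsmul, hP, two_nsmul_eq_zero_iff two_ne_zero]
    simp, Or.inl rfl⟩ : _ ∈ torsionCoordinates (twistedCurve d) 4)
  change _ ∈ divisionField ℚ (twistedCurve d) 4 at hx
  have hdK : algebraMap ℚ Ω d ∈ divisionField ℚ (twistedCurve d) 4 :=
    IntermediateField.algebraMap_mem _ d
  have hi_eq : i = ((0 + (3 * i * s + 0) * (3 * i * s + 4 * s)) / algebraMap ℚ Ω d + 9) / 12 := by
    rw [eq_div_iff (by norm_num), ← sub_eq_iff_eq_add, eq_div_iff hD, ← hs]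
    linear_combination -9 * s ^ 2 * hi
  rw [hi_eq]
  exact div_mem (add_mem (div_mem hx hdK) (ofNat_mem _ 9)) (ofNat_mem _ 12)

/-- The point (15d, 120s³) is a half of (0, 0), via u = (0, 3s, 5s). Halving it once more gives
8-torsion with the abscissa shown. -/
theorem X_mem_divisionField_eight (hd : d ≠ 0) (hs : s ^ 2 = algebraMap ℚ Ω d)
    {u₁ u₂ u₃ : Ω} (h₁ : u₁ ^ 2 = 15 * algebraMap ℚ Ω d) (h₂ : u₂ ^ 2 = 24 * algebraMap ℚ Ω d)
    (h₃ : u₃ ^ 2 = 40 * algebraMap ℚ Ω d) (hu : u₁ * u₂ * u₃ = 120 * s ^ 3) :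
    (u₁ + u₂) * (u₁ + u₃) ∈ divisionField ℚ (twistedCurve d) 8 := by
  classical
  have hD : algebraMap ℚ Ω d ≠ 0 := by rwa [Ne, map_eq_zero]
  obtain ⟨h₁₂, h₁₃, h₂₃⟩ := roots_ne hD
  obtain ⟨h, h', hP⟩ := exists_half (u₁ := u₁) (u₂ := u₂) (u₃ := u₃) two_ne_zero
    h₁₂ h₁₃ h₂₃ (by linear_combination h₁ - h₂) (by linear_combination h₁ - h₃)
  obtain ⟨g, g', hQ⟩ := exists_half (u₁ := 0) (u₂ := 3 * s) (u₃ := 5 * s) two_ne_zero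
    h₁₂ h₁₃ h₂₃ (by linear_combination -9 * hs) (by linear_combination -25 * hs)
  have hPQ : Affine.Point.some _ _ h' = Affine.Point.some _ _ g := by
    congr 1
    · linear_combination h₁ - 15 * hs
    · linear_combination hu
  have hx := IntermediateField.subset_adjoin ℚ _ (mem_torsionCoordinates.2 ⟨_, _, h,
    (mul_nsmul _ 2 4).trans ((mul_nsmul _ 2 2).trans (by
      rw [hP, hPQ, hQ, two_nsmul_eq_zero_iff two_ne_zero]
      ring)), Or.inl rfl⟩ : _ ∈ torsionCoordinates (twistedCurve d) 8)
  rwa [zero_add] at hx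

/-- The sign choices (u₁, u₂, u₃) and (-u₁, -u₂, u₃) give two halves of the same point. Their
abscissas sum to 2u₁² + 2u₁u₂ = (30 + 12√10)d. -/
theorem mul_mem_divisionField_eight (hd : d ≠ 0) (hs : s ^ 2 = algebraMap ℚ Ω d)
    (hr₂ : r₂ ^ 2 = 2) (hr₃ : r₃ ^ 2 = 3) (hr₅ : r₅ ^ 2 = 5) :
    r₂ * r₅ ∈ divisionField ℚ (twistedCurve d) 8 := by
  have hD : algebraMap ℚ Ω d ≠ 0 := by rwa [Ne, map_eq_zero]
  have h₁ : (r₃ * r₅ * s) ^ 2 = 15 * algebraMap ℚ Ω d := by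
    simp only [mul_pow, hr₃, hr₅, hs]; ring
  have h₂ : (2 * r₂ * r₃ * s) ^ 2 = 24 * algebraMap ℚ Ω d := by
    simp only [mul_pow, hr₂, hr₃, hs]; ring
  have h₃ : (2 * r₂ * r₅ * s) ^ 2 = 40 * algebraMap ℚ Ω d := by
    simp only [mul_pow, hr₂, hr₅, hs]; ring
  have hu : r₃ * r₅ * s * (2 * r₂ * r₃ * s) * (2 * r₂ * r₅ * s) = 120 * s ^ 3 := by
    calc _ = 4 * r₂ ^ 2 * r₃ ^ 2 * r₅ ^ 2 * s ^ 3 := by ring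
      _ = _ := by rw [hr₂, hr₃, hr₅]; ring
  have hx := X_mem_divisionField_eight hd hs h₁ h₂ h₃ hu
  have hx' := X_mem_divisionField_eight hd hs ((neg_sq _).trans h₁) ((neg_sq _).trans h₂) h₃
    ((by ring : _ = _).trans hu)
  have hdK : algebraMap ℚ Ω d ∈ divisionField ℚ (twistedCurve d) 8 :=
    IntermediateField.algebraMap_mem _ d
  have heq : r₂ * r₅ = (((r₃ * r₅ * s + 2 * r₂ * r₃ * s) * (r₃ * r₅ * s + 2 * r₂ * r₅ * s) +
      (-(r₃ * r₅ * s) + -(2 * r₂ * r₃ * s)) * (-(r₃ * r₅ * s) + 2 * r₂ * r₅ * s)) /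
        algebraMap ℚ Ω d - 30) / 12 := by
    rw [eq_div_iff (by norm_num), eq_sub_iff_add_eq, eq_div_iff hD, ← hs]
    linear_combination -(2 * s ^ 2 * r₅ ^ 2 + 4 * s ^ 2 * r₂ * r₅) * hr₃ - 6 * s ^ 2 * hr₅
  rw [heq]
  exact div_mem (sub_mem (div_mem (add_mem hx hx') hdK) (ofNat_mem _ 30)) (ofNat_mem _ 12)

theorem exists_sqrt (a : Ω) : ∃ z : Ω, z ^ 2 = a := IsAlgClosed.exists_pow_nat_eq a two_pos

end twistedCurve

/-! ### Conclusion -/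

open twistedCurve in
theorem mainTheorem8 :
    {c : CurveClass | ∃ E : WeierstrassCurve ℚ, E.IsElliptic ∧
      (Quotient.mk'' E : CurveClass) = c ∧
      (∃ t : ℕ, IsElementaryTwoExtension (divisionField ℚ E 8) t) ∧
      RestrictionSplits (divisionField ℚ E 4) (divisionField ℚ E 8) ∧
      ∃ (L : IntermediateField ℚ (AlgebraicClosure ℚ)) (r : ℕ),
        1 ≤ r ∧ r ≤ 4 ∧ IsElementaryTwoExtension L r ∧
        IsMinimalBaseChange E 4 8 L ∧
        divisionField L E 4 = divisionField L E 8 ∧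
        divisionField L E 4 ≠ ⊥}.Infinite := by
  classical
  refine Set.infinite_of_injective_forall_mem mk_injective_on_primes fun ⟨p, hp⟩ => ?_
  have hd : (p : ℚ) ≠ 0 := Nat.cast_ne_zero.2 hp.ne_zero
  refine ⟨twistedCurve p, isElliptic hd, rfl, ?_⟩
  obtain ⟨i, hi⟩ := exists_sqrt (-1)
  obtain ⟨s, hs⟩ := exists_sqrt (algebraMap ℚ _ (p : ℚ))
  obtain ⟨r₂, hr₂⟩ := exists_sqrt 2
  obtain ⟨r₃, hr₃⟩ := exists_sqrt 3
  obtain ⟨r₅, hr₅⟩ := exists_sqrt 5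
  have hi4 := mem_divisionField_four hd hi hs
  -- The list is redundant for p = 2, 3, 5, which is harmless: only the bound of five is needed.
  refine exists_minimalBaseChange {i, r₂, r₃, r₅, s} Finset.card_le_five ?_ ?_ ?_ ?_
  · simp only [Finset.mem_insert, Finset.mem_singleton]
    rintro x (rfl | rfl | rfl | rfl | rfl)
    exacts [⟨-1, by simp [hi]⟩, ⟨2, by simp [hr₂]⟩, ⟨3, by simp [hr₃]⟩, ⟨5, by simp [hr₅]⟩, ⟨p, hs⟩]
  · simpa using divisionField_eight_le hi hs hr₂ hr₃ hr₅
  · refine lt_of_le_not_ge (divisionField_four_le_eight _) fun hle => ?_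
    -- If the fields agreed, √10 would lie in ℚ(i, √p), making one of ±10, ±10p a rational square.
    have hr : (r₂ * r₅) ^ 2 = algebraMap ℚ _ 10 := by
      rw [mul_pow, hr₂, hr₅, map_ofNat]; norm_num
    obtain ⟨c, hc⟩ := IntermediateField.exists_sq_of_mem_adjoin_pair hi hs hr
      (divisionField_four_le hi hs (hle (mul_mem_divisionField_eight hd hs hr₂ hr₃ hr₅)))
    have hp0 : (0 : ℚ) < p := Nat.cast_pos.2 hp.pos
    rcases hc with hc | hc | hc | hc
    · have : IsSquare ((10 : ℕ) : ℚ) := ⟨c, by rw [← sq, hc]; norm_num⟩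
      rw [Rat.isSquare_natCast_iff] at this
      obtain ⟨m, hm⟩ := this
      have hm4 : m < 4 := by nlinarith
      interval_cases m <;> omega
    · nlinarith [sq_nonneg c]
    · refine hp.not_isSquare_ten_mul (Rat.isSquare_natCast_iff.1 ⟨c, ?_⟩)
      rw [← sq, hc, Nat.cast_mul, mul_comm]
      norm_num
    · nlinarith [sq_nonneg c]
  · intro hbot
    rw [hbot, IntermediateField.mem_bot] at hi4
    obtain ⟨q, rfl⟩ := hi4
    rw [← map_pow, ← map_one (algebraMap ℚ (AlgebraicClosure ℚ)), ← map_neg] at hi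
    have := (algebraMap ℚ (AlgebraicClosure ℚ)).injective hi
    nlinarith [sq_nonneg q]
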